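/- Let $X$ be a finite simple graph with adjacency matrix $A$, and for real $t$ let $U(t)=e^{itA}$. We say that $X$ has perfect state transfer at time $\tau$ if there are distinct vertices $u,v$ of $X$ and $\lambda\in\mathbb{C}$ with $U(\tau)e_u=\lambda e_v$, where $e_w$ denotes the standard basis vector indexed by the vertex $w$; and that $X$ has perfect state transfer if this holds for some $\tau\ge 0$. A connected graph is distance-regular if there are numbers $b_i,c_i$ $(i\ge 0)$ such that for any vertices $u,v$ at distance $i$, the number of neighbours of $v$ at distance $i-1$ from $u$ is $c_i$ and the number of neighbours of $v$ at distance $i+1$ from $u$ is $b_i$. Let $X$ be a distance-regular graph of diameter $2$ (that is, a connected strongly regular graph of diameter $2$). Then $X$ has perfect state transfer if and only if $X$ is isomorphic to the complement of the disjoint union of $m$ copies of $K_2$ for some even $m$. In that case, $X$ has perfect state transfer at time $\pi/2$. Moreover, for every even $m\ge 2$ the complement of the disjoint union of $m$ copies of $K_2$ is a distance-regular graph of diameter $2$. -/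

import Mathlib

namespace SimpleGraph

/-- A connected graph is distance-regular if there are numbers `b i`, `c i` such that for all
vertices `u`, `v` at distance `i`, exactly `c i` neighbours of `v` are at distance `i - 1` from `u`
and exactly `b i` neighbours of `v` are at distance `i + 1` from `u`. -/
def IsDistanceRegular {V : Type*} (G : SimpleGraph V) : Prop :=
  G.Connected ∧ ∃ b c : ℕ → ℕ, ∀ (i : ℕ) (u v : V), G.dist u v = i →
    {w | G.Adj v w ∧ G.dist u w + 1 = i}.ncard = c i ∧
    {w | G.Adj v w ∧ G.dist u w = i + 1}.ncard = b i

/-- The disjoint union of `m` copies of a graph `H`. -/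
def disjointCopies {W : Type*} (m : ℕ) (H : SimpleGraph W) : SimpleGraph (Fin m × W) where
  Adj p q := p.1 = q.1 ∧ H.Adj p.2 q.2
  symm := ⟨fun _ _ h => ⟨h.1.symm, h.2.symm⟩⟩
  loopless := ⟨fun _ h => H.irrefl h.2⟩

variable {V : Type*} [Fintype V] [DecidableEq V] (G : SimpleGraph V) [DecidableRel G.Adj]

/-- The transition matrix `U(t) = exp(i t A)` of the continuous-time quantum walk on `G`, where
`A` is the adjacency matrix. -/
noncomputable def quantumWalk (t : ℝ) : Matrix V V ℂ :=
  NormedSpace.exp ((Complex.I * (t : ℂ)) • G.adjMatrix ℂ)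

/-- `G` has perfect state transfer at time `τ`: for some distinct vertices `u`, `v`, the vector
`U(τ) e_u` is a multiple of `e_v`. -/
def HasPerfectStateTransferAt (τ : ℝ) : Prop :=
  ∃ u v : V, u ≠ v ∧
    ∃ z : ℂ, (G.quantumWalk τ).mulVec (Pi.single u 1) = z • (Pi.single v 1 : V → ℂ)

/-- `G` has perfect state transfer (at some non-negative time). -/
def HasPerfectStateTransfer : Prop :=
  ∃ τ : ℝ, 0 ≤ τ ∧ G.HasPerfectStateTransferAt τ

end SimpleGraph

/-! In a distance-regular graph the entries of every power of `A`, hence of `U(t)`, depend only on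
distance (`quantumWalk_apply_eq`). So transfer from `u` to `v` forces `v` to be alone at its
distance from `u` (`eq_of_dist_eq`). In diameter 2 that distance must be 2, and regularity then
gives every vertex exactly one non-neighbour: the graph is a cocktail party graph. On `2m` vertices
its eigenvalues are 0, -2 and 2m - 2. Splitting `e_u` into eigenvectors reduces antipodal transfer
to `exp(-2it) = exp((2m - 2)it) = -1`; this forces `(-1)^m = 1`, and for even `m` it holds at `t =
π/2`. -/

namespace SimpleGraph

open Matrix

/-! ### Matrix exponentials: power series and eigenvectors. -/

section Exponential

variable {V : Type*} [Fintype V] [DecidableEq V]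

theorem hasSum_matrix_exp_smul (A : Matrix V V ℂ) (s : ℂ) :
    HasSum (fun n : ℕ => ((n.factorial : ℂ)⁻¹ * s ^ n) • A ^ n) (NormedSpace.exp (s • A)) := by
  let _ : SeminormedRing (Matrix V V ℂ) := Matrix.linftyOpSemiNormedRing
  let _ : NormedRing (Matrix V V ℂ) := Matrix.linftyOpNormedRing
  let _ : NormedAlgebra ℂ (Matrix V V ℂ) := Matrix.linftyOpNormedAlgebra
  have h := NormedSpace.exp_series_hasSum_exp' (𝕂 := ℂ) (s • A)
  simp only [smul_pow, smul_smul] at h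
  exact h

theorem matrix_exp_smul_mulVec (A : Matrix V V ℂ) (s θ : ℂ) (f : V → ℂ)
    (hf : A *ᵥ f = θ • f) :
    NormedSpace.exp (s • A) *ᵥ f = Complex.exp (s * θ) • f := by
  have hpow : ∀ n : ℕ, A ^ n *ᵥ f = θ ^ n • f := by
    intro n
    induction n with
    | zero => simp
    | succ n ih => rw [pow_succ, ← Matrix.mulVec_mulVec, hf, Matrix.mulVec_smul, ih, smul_smul,
        pow_succ']
  have h1 := (hasSum_matrix_exp_smul A s).map
    (⟨⟨fun M : Matrix V V ℂ => M *ᵥ f, Matrix.zero_mulVec f⟩,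
      fun M N => Matrix.add_mulVec M N f⟩ : Matrix V V ℂ →+ (V → ℂ))
    (by
      change Continuous fun M : Matrix V V ℂ => M *ᵥ f
      fun_prop)
  have h2 : HasSum (fun n : ℕ => ((n.factorial : ℂ)⁻¹ * (s * θ) ^ n) • f)
      (Complex.exp (s * θ) • f) := by
    have h := NormedSpace.exp_series_hasSum_exp' (𝕂 := ℂ) (s * θ)
    rw [← Complex.exp_eq_exp_ℂ] at h
    exact h.smul_const f
  refine h1.unique ?_
  convert h2 using 2 with n
  change (((n.factorial : ℂ)⁻¹ * s ^ n) • A ^ n) *ᵥ f = _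
  rw [Matrix.smul_mulVec, hpow, smul_smul, mul_pow, mul_assoc]

theorem matrix_exp_smul_apply_eq {A : Matrix V V ℂ} {u v u' v' : V}
    (h : ∀ n : ℕ, (A ^ n) u v = (A ^ n) u' v') (s : ℂ) :
    NormedSpace.exp (s • A) u v = NormedSpace.exp (s • A) u' v' := by
  have hs := hasSum_matrix_exp_smul A s
  have h1 := Pi.hasSum.1 (Pi.hasSum.1 hs u) v
  have h2 := Pi.hasSum.1 (Pi.hasSum.1 hs u') v'
  refine h1.unique ?_
  convert h2 using 2 with n
  simp only [Matrix.smul_apply, h n]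

end Exponential

/-! ### Walks on distance-regular graphs. -/

section DistanceRegular

theorem IsDistanceRegular.exists_degree_eq {V : Type*} [Fintype V] {G : SimpleGraph V}
    [DecidableRel G.Adj] (hG : G.IsDistanceRegular) :
    ∃ k, ∀ v, G.degree v = k := by
  obtain ⟨-, b, c, h⟩ := hG
  refine ⟨b 0, fun v => ?_⟩
  rw [← (h 0 v v G.dist_self).2, ← card_neighborFinset_eq_degree, ← Set.ncard_coe_finset]
  congr 1
  ext w
  simp only [coe_neighborFinset, mem_neighborSet, Set.mem_ofPred_eq, zero_add]
  exact ⟨fun hw => ⟨hw, dist_eq_one_iff_adj.2 hw⟩, fun hw => hw.1⟩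

variable {V : Type*} [Fintype V] [DecidableEq V] {G : SimpleGraph V} [DecidableRel G.Adj]

/-- Induction on `n`: the neighbours of `v` lie at distance `d - 1`, `d` or `d + 1` from `u`, in
numbers that depend only on `d = G.dist u v`. -/
theorem IsDistanceRegular.exists_adjMatrix_pow_apply_eq (hG : G.IsDistanceRegular) (n : ℕ) :
    ∃ f : ℕ → ℂ, ∀ u v, (G.adjMatrix ℂ ^ n) u v = f (G.dist u v) := by
  obtain ⟨k, hk⟩ := hG.exists_degree_eq
  have hconn := hG.1
  obtain ⟨-, b, c, h⟩ := hG
  induction n with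
  | zero =>
    refine ⟨fun d => if d = 0 then 1 else 0, fun u v => ?_⟩
    simp [Matrix.one_apply, hconn.dist_eq_zero_iff]
  | succ n ih =>
    obtain ⟨f, hf⟩ := ih
    -- The truncated `d - 1` at `d = 0` is harmless: no `w` has `G.dist u w + 1 = 0`.
    refine ⟨fun d => c d * f (d - 1) + b d * f (d + 1) + (k - c d - b d) * f d, fun u v => ?_⟩
    obtain ⟨hc, hb⟩ := h _ u v rfl
    rw [pow_succ, mul_adjMatrix_apply]
    simp only [hf]
    set d := G.dist u v
    have hc' : ((G.neighborFinset v).filter (fun w => G.dist u w + 1 = d)).card = c d := by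
      rw [← hc, ← Set.ncard_coe_finset]; congr 1; ext w; simp
    have hb' : ((G.neighborFinset v).filter (fun w => G.dist u w = d + 1)).card = b d := by
      rw [← hb, ← Set.ncard_coe_finset]; congr 1; ext w; simp
    have key : ∀ w ∈ G.neighborFinset v, f (G.dist u w) =
        (if G.dist u w + 1 = d then f (d - 1) - f d else 0) +
        (if G.dist u w = d + 1 then f (d + 1) - f d else 0) + f d := by
      intro w hw
      have hadj : G.Adj v w := by simpa using hw
      rcases hadj.diff_dist_adj (u := u) with h0 | h0 | h0
      · have h1 : G.dist u w = d := h0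
        simp [h1]
      · have h1 : G.dist u w = d + 1 := h0
        have h2 : d + 1 + 1 ≠ d := by omega
        simp [h1, h2]
      · by_cases hd : G.dist u w = d
        · simp [hd]
        · have h1 : G.dist u w + 1 = d := by omega
          have h2 : G.dist u w = d - 1 := by omega
          have h3 : G.dist u w ≠ d + 1 := by omega
          rw [if_pos h1, if_neg h3, h2]; ring
    rw [Finset.sum_congr rfl key, Finset.sum_add_distrib, Finset.sum_add_distrib,
      ← Finset.sum_filter, ← Finset.sum_filter, Finset.sum_const, Finset.sum_const,
      Finset.sum_const, hc', hb', card_neighborFinset_eq_degree, hk]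
    simp only [nsmul_eq_mul]
    ring

theorem IsDistanceRegular.quantumWalk_apply_eq (hG : G.IsDistanceRegular) (t : ℝ) {u v u' v' : V}
    (h : G.dist u v = G.dist u' v') : G.quantumWalk t u v = G.quantumWalk t u' v' := by
  refine matrix_exp_smul_apply_eq (fun n => ?_) _
  obtain ⟨f, hf⟩ := hG.exists_adjMatrix_pow_apply_eq n
  rw [hf, hf, h]

/-- Perfect state transfer in a distance-regular graph from `u` to `v` forces `v` to be the only
vertex at its distance from `u`. -/
theorem IsDistanceRegular.eq_of_dist_eq (hG : G.IsDistanceRegular) {t : ℝ} {u v w : V} {z : ℂ}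
    (hz : (G.quantumWalk t).mulVec (Pi.single u 1) = z • (Pi.single v 1 : V → ℂ))
    (hw : G.dist u w = G.dist u v) : w = v := by
  have hz0 : z ≠ 0 := by
    rintro rfl
    have hinj := Matrix.mulVec_injective_of_isUnit
      (Matrix.isUnit_exp ((Complex.I * (t : ℂ)) • G.adjMatrix ℂ))
    have h0 : (Pi.single u 1 : V → ℂ) = 0 := hinj (by
      change (G.quantumWalk t).mulVec (Pi.single u 1) = _
      rw [hz, zero_smul]; exact (Matrix.mulVec_zero _).symm)
    simpa using congrFun h0 u
  by_contra hne
  have h1 := congrFun hz v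
  have h2 := congrFun hz w
  simp only [Matrix.mulVec_single_one, Matrix.col_apply, Pi.smul_apply, Pi.single_eq_same,
    smul_eq_mul, mul_one, Pi.single_eq_of_ne hne, mul_zero] at h1 h2
  -- Equal distances give equal entries at `v` and `w`, yet these are `z` and `0`.
  rw [hG.quantumWalk_apply_eq t (u' := v) (v' := u) (by rw [dist_comm, hw, dist_comm]), h1] at h2
  exact hz0 h2

end DistanceRegular

/-! ### Cocktail party graphs: structure and distances. -/

/-- `G` is a cocktail party graph with antipodal map `σ`: every vertex is adjacent to all vertices
other than itself and its antipode. -/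
structure IsCocktailParty {V : Type*} (G : SimpleGraph V) (σ : V → V) : Prop where
  ne : ∀ u, σ u ≠ u
  invol : ∀ u, σ (σ u) = u
  adj_iff : ∀ u w, G.Adj u w ↔ w ≠ u ∧ w ≠ σ u

section CocktailParty

variable {V : Type*} {G : SimpleGraph V} {σ : V → V}

theorem exists_isCocktailParty_of_iso {m : ℕ}
    (e : G ≃g (disjointCopies m (completeGraph (Fin 2)))ᶜ) : ∃ σ, G.IsCocktailParty σ := by
  have hinv : ∀ i : Fin 2, 1 - (1 - i) = i := by decide
  have hne : ∀ i : Fin 2, 1 - i ≠ i := by decide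
  have htwo : ∀ i j : Fin 2, i ≠ j ↔ j = 1 - i := by decide
  refine ⟨fun u => e.symm ((e u).1, 1 - (e u).2), fun u h => ?_, fun u => ?_, fun u w => ?_⟩
  · have h' := congrArg e h
    simp only [RelIso.apply_symm_apply] at h'
    exact hne _ (congrArg Prod.snd h')
  · simp [hinv]
  · rw [← e.map_rel_iff, compl_adj]
    have h1 : w ≠ u ↔ e u ≠ e w := by rw [e.injective.ne_iff, ne_comm]
    have h2 : w = e.symm ((e u).1, 1 - (e u).2) ↔ e w = ((e u).1, 1 - (e u).2) :=
      ⟨fun h => by rw [h, RelIso.apply_symm_apply], fun h => by rw [← h, RelIso.symm_apply_apply]⟩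
    rw [h1, Ne, Ne, h2, Prod.ext_iff (x := e w)]
    refine and_congr_right fun _ => not_congr ?_
    change (e u).1 = (e w).1 ∧ (e u).2 ≠ (e w).2 ↔ _
    rw [htwo, eq_comm (a := (e u).1)]

theorem card_eq_of_iso [Fintype V] {m : ℕ}
    (e : G ≃g (disjointCopies m (completeGraph (Fin 2)))ᶜ) : Fintype.card V = 2 * m := by
  rw [Fintype.card_congr e.toEquiv]
  simp [mul_comm]

/-- The antipodal pairs index the copies of `K_2`; a chosen representative of each pair supplies the
`Fin 2` coordinate. -/
theorem IsCocktailParty.exists_iso [Fintype V] (h : G.IsCocktailParty σ) :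
    ∃ m : ℕ, Fintype.card V = 2 * m ∧
      Nonempty (G ≃g (disjointCopies m (completeGraph (Fin 2)))ᶜ) := by
  classical
  let s : Setoid V :=
    { r := fun u w => w = u ∨ w = σ u
      iseqv :=
        { refl := fun u => Or.inl rfl
          symm := by
            rintro u w (rfl | rfl)
            · exact Or.inl rfl
            · exact Or.inr (h.invol u).symm
          trans := by
            rintro u w x (rfl | rfl) (rfl | rfl)
            · exact Or.inl rfl
            · exact Or.inr rfl
            · exact Or.inr rfl
            · exact Or.inl (h.invol u) } }
  have hout : ∀ w : V, w = (Quotient.mk s w).out ∨ w = σ (Quotient.mk s w).out :=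
    fun w => Quotient.exact (Quotient.out_eq (Quotient.mk s w))
  have hmkσ : ∀ w : V, Quotient.mk s (σ w) = Quotient.mk s w :=
    fun w => Quotient.sound (Or.inr (h.invol w).symm)
  let e : V ≃ Quotient s × Fin 2 :=
    { toFun := fun w => (Quotient.mk s w, if w = (Quotient.mk s w).out then 0 else 1)
      invFun := fun p => if p.2 = 0 then p.1.out else σ p.1.out
      left_inv := fun w => by
        by_cases hw : w = (Quotient.mk s w).out
        · simp only [if_pos hw, if_true]; exact hw.symm
        · simp only [if_neg hw]
          exact ((hout w).resolve_left hw).symm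
      right_inv := by
        rintro ⟨q, i⟩
        fin_cases i
        · simp
        · simp [hmkσ, h.ne] }
  let m := Fintype.card (Quotient s)
  let e' : V ≃ Fin m × Fin 2 := e.trans ((Fintype.equivFin _).prodCongr (Equiv.refl _))
  have hcls : ∀ u w : V, (e' u).1 = (e' w).1 ↔ w = u ∨ w = σ u := by
    intro u w
    change Fintype.equivFin _ (Quotient.mk s u) = Fintype.equivFin _ (Quotient.mk s w) ↔ _
    rw [EmbeddingLike.apply_eq_iff_eq]
    exact Quotient.eq
  refine ⟨m, ?_, ⟨⟨e', ?_⟩⟩⟩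
  · rw [Fintype.card_congr e']; simp [mul_comm]
  · intro u w
    rw [compl_adj, h.adj_iff, e'.injective.ne_iff, ne_comm]
    refine and_congr_right fun hne => not_congr ?_
    change (e' u).1 = (e' w).1 ∧ (e' u).2 ≠ (e' w).2 ↔ _
    rw [hcls]
    refine ⟨fun hh => hh.1.resolve_left hne, fun hh => ⟨Or.inr hh, fun h2 => hne ?_⟩⟩
    exact (e'.injective (Prod.ext ((hcls u w).2 (Or.inr hh)) h2)).symm

theorem IsCocktailParty.dist_antipode (h : G.IsCocktailParty σ) {u p : V} (hp : p ≠ u)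
    (hp' : p ≠ σ u) : G.dist u (σ u) = 2 := by
  have hup : G.Adj u p := (h.adj_iff u p).2 ⟨hp, hp'⟩
  have hpu : G.Adj p (σ u) := (h.adj_iff _ _).2 ⟨hp'.symm, fun hh => hp (by
    rw [← h.invol u, hh, h.invol])⟩
  have hle : G.dist u (σ u) ≤ 2 := by
    simpa using dist_le (Walk.cons hup (Walk.cons hpu Walk.nil))
  have hr : G.Reachable u (σ u) := hup.reachable.trans hpu.reachable
  have := hr.one_lt_dist_of_ne_of_not_adj (h.ne u).symm (fun hh => ((h.adj_iff _ _).1 hh).2 rfl)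
  omega

theorem IsCocktailParty.dist_eq [DecidableEq V] (h : G.IsCocktailParty σ)
    (hex : ∀ u, ∃ p, p ≠ u ∧ p ≠ σ u) (u w : V) :
    G.dist u w = if w = u then 0 else if w = σ u then 2 else 1 := by
  split_ifs with h1 h2
  · rw [h1, dist_self]
  · obtain ⟨p, hp, hp'⟩ := hex u
    rw [h2, h.dist_antipode hp hp']
  · exact dist_eq_one_iff_adj.2 ((h.adj_iff _ _).2 ⟨h1, h2⟩)

theorem IsCocktailParty.connected [Nonempty V] (h : G.IsCocktailParty σ)
    (hex : ∀ u, ∃ p, p ≠ u ∧ p ≠ σ u) : G.Connected := by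
  classical
  refine ⟨fun u w => ?_⟩
  by_cases hw : w = u
  · rw [hw]
  · refine Reachable.of_dist_ne_zero ?_
    rw [h.dist_eq hex]
    split_ifs <;> decide

theorem IsCocktailParty.exists_ne_of_two_lt_card [Fintype V] (hcard : 2 < Fintype.card V)
    (u : V) : ∃ p, p ≠ u ∧ p ≠ σ u := by
  classical
  by_contra! hcon
  have hsub : (Finset.univ : Finset V) ⊆ {u, σ u} := by
    intro p _
    by_cases hp : p = u
    · simp [hp]
    · simp [hcon p hp]
  have := (Finset.card_le_card hsub).trans Finset.card_le_two
  rw [Finset.card_univ] at this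
  omega

theorem IsCocktailParty.diam_eq_two [Fintype V] (h : G.IsCocktailParty σ)
    (hcard : 2 < Fintype.card V) : G.diam = 2 := by
  classical
  have hex := IsCocktailParty.exists_ne_of_two_lt_card (σ := σ) hcard
  have : Nonempty V := Fintype.card_pos_iff.1 (by omega)
  have hconn := h.connected hex
  obtain ⟨u, w, huw⟩ := G.exists_dist_eq_diam
  have hle : G.diam ≤ 2 := by
    rw [← huw, h.dist_eq hex]
    split_ifs <;> decide
  have hge : G.dist u (σ u) ≤ G.diam := dist_le_diam (connected_iff_ediam_ne_top.1 hconn)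
  rw [h.dist_eq hex, if_neg (h.ne u), if_pos rfl] at hge
  omega

theorem IsCocktailParty.isDistanceRegular [Fintype V] (h : G.IsCocktailParty σ)
    (hcard : 2 < Fintype.card V) : G.IsDistanceRegular := by
  classical
  have hex := IsCocktailParty.exists_ne_of_two_lt_card (σ := σ) hcard
  have : Nonempty V := Fintype.card_pos_iff.1 (by omega)
  have hinj : Function.Injective σ := fun a b hab => by rw [← h.invol a, hab, h.invol]
  have hdeg : ∀ v, {w | w ≠ v ∧ w ≠ σ v}.ncard = Fintype.card V - 2 := by
    intro v
    have : {w | w ≠ v ∧ w ≠ σ v} = ({v, σ v} : Set V)ᶜ := by ext w; simp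
    rw [this, Set.ncard_compl, Nat.card_eq_fintype_card, Set.ncard_pair (h.ne v).symm]
  -- With `n` vertices: `b 0 = n - 2`; `b 1 = c 1 = 1`, counting `σ u` and `u`; `c 2 = n - 2`, as
  -- antipodes have the same neighbours.
  refine ⟨h.connected hex, fun i => if i = 0 then Fintype.card V - 2 else if i = 1 then 1 else 0,
    fun i => if i = 0 then 0 else if i = 1 then 1 else Fintype.card V - 2, ?_⟩
  rintro i u v rfl
  have hd := h.dist_eq hex
  by_cases h1 : v = u
  · subst h1
    rw [dist_self]
    constructor
    · simp
    · simp only [if_true]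
      rw [← hdeg v]
      congr 1
      ext w
      simp only [Set.mem_ofPred_eq, zero_add, dist_eq_one_iff_adj, and_self, h.adj_iff]
  · by_cases h2 : v = σ u
    · subst h2
      have hne := h.ne u
      rw [hd u (σ u), if_neg hne, if_pos rfl]
      constructor
      · simp only [OfNat.ofNat_ne_zero, if_false, OfNat.ofNat_ne_one]
        rw [← hdeg u]
        congr 1
        ext w
        simp only [Set.mem_ofPred_eq, h.adj_iff, h.invol, hd]
        split_ifs
        all_goals simp_all
      · simp only [OfNat.ofNat_ne_zero, if_false, OfNat.ofNat_ne_one]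
        rw [Set.ncard_eq_zero]
        ext w
        simp only [Set.mem_ofPred_eq, hd, Set.mem_empty_iff_false, iff_false, not_and]
        intro _
        split_ifs <;> decide
    · rw [hd u v, if_neg h1, if_neg h2]
      constructor
      · simp only [one_ne_zero, if_false, if_true]
        rw [Set.ncard_eq_one]
        refine ⟨u, ?_⟩
        ext w
        simp only [Set.mem_ofPred_eq, hd, h.adj_iff, Set.mem_singleton_iff]
        constructor
        · rintro ⟨_, hw⟩
          by_contra hwu
          rw [if_neg hwu] at hw
          split_ifs at hw <;> omega
        · rintro rfl
          exact ⟨⟨Ne.symm h1, fun hh => h2 (by rw [hh, h.invol])⟩, by simp⟩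
      · simp only [one_ne_zero, if_false, if_true]
        rw [Set.ncard_eq_one]
        refine ⟨σ u, ?_⟩
        ext w
        simp only [Set.mem_ofPred_eq, hd, h.adj_iff, Set.mem_singleton_iff]
        constructor
        · rintro ⟨_, hw⟩
          by_contra hwu
          rw [if_neg hwu] at hw
          split_ifs at hw
          omega
        · rintro rfl
          exact ⟨⟨Ne.symm h2, fun hh => h1 (hinj hh).symm⟩, by rw [if_neg (h.ne u), if_pos rfl]⟩

end CocktailParty

/-! ### The walk on cocktail party graphs, and reduction to them. -/

section QuantumWalk

variable {V : Type*} [Fintype V] [DecidableEq V] {G : SimpleGraph V} [DecidableRel G.Adj]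
  {σ : V → V}

theorem IsCocktailParty.adjMatrix_mulVec (h : G.IsCocktailParty σ) (f : V → ℂ) (u : V) :
    (G.adjMatrix ℂ *ᵥ f) u = ∑ w, f w - f u - f (σ u) := by
  have hN : G.neighborFinset u = (Finset.univ.erase u).erase (σ u) := by
    ext w
    simp [h.adj_iff, and_comm]
  rw [adjMatrix_mulVec_apply, hN,
    Finset.sum_erase_eq_sub (Finset.mem_erase.2 ⟨h.ne u, Finset.mem_univ _⟩),
    Finset.sum_erase_eq_sub (Finset.mem_univ _)]

/-- The quantum walk on a cocktail party graph with `n` vertices, written in the eigenbasis: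
the eigenvalues of the adjacency matrix are `0`, `-2` and `n - 2`. -/
theorem IsCocktailParty.quantumWalk_mulVec_single (h : G.IsCocktailParty σ) (t : ℝ) (u : V) :
    (G.quantumWalk t) *ᵥ (Pi.single u 1) =
      (1 / 2 : ℂ) • (Pi.single u 1 - Pi.single (σ u) 1 : V → ℂ) +
      (Complex.exp (Complex.I * t * -2) / 2) • (Pi.single u 1 + Pi.single (σ u) 1 -
        fun _ => 2 / (Fintype.card V : ℂ)) +
      (Complex.exp (Complex.I * t * (Fintype.card V - 2))) •
        (fun _ => 1 / (Fintype.card V : ℂ) : V → ℂ) := by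
  have hn : (Fintype.card V : ℂ) ≠ 0 := by
    have : Nonempty V := ⟨u⟩
    exact_mod_cast Fintype.card_ne_zero
  have hsw : ∀ w, (σ w = u ↔ w = σ u) := fun w =>
    ⟨fun hh => by rw [← hh, h.invol], fun hh => by rw [hh, h.invol]⟩
  have hsw' : ∀ w, (σ w = σ u ↔ w = u) := fun w =>
    ⟨fun hh => by rw [← h.invol w, hh, h.invol], fun hh => by rw [hh]⟩
  -- The parts of `e_u`: antisymmetric under the antipode, symmetric with entries summing to zero,
  -- and constant.
  set f : V → ℂ := Pi.single u 1 - Pi.single (σ u) 1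
  set g : V → ℂ := Pi.single u 1 + Pi.single (σ u) 1 - fun _ => 2 / (Fintype.card V : ℂ)
  set c : V → ℂ := fun _ => 1 / (Fintype.card V : ℂ)
  have hf : G.adjMatrix ℂ *ᵥ f = (0 : ℂ) • f := by
    ext w
    rw [h.adjMatrix_mulVec]
    simp [f, Pi.single_apply, hsw, hsw']
  have hg : G.adjMatrix ℂ *ᵥ g = (-2 : ℂ) • g := by
    ext w
    rw [h.adjMatrix_mulVec]
    simp only [g, Pi.sub_apply, Pi.add_apply, Pi.single_apply, Finset.sum_sub_distrib,
      Finset.sum_add_distrib, Finset.sum_ite_eq', Finset.mem_univ, if_true, hsw, hsw',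
      Finset.sum_const, Finset.card_univ, nsmul_eq_mul, Pi.smul_apply, smul_eq_mul,
      mul_div_cancel₀ _ hn]
    field_simp
    ring
  have hc : G.adjMatrix ℂ *ᵥ c = (Fintype.card V - 2 : ℂ) • c := by
    ext w
    rw [h.adjMatrix_mulVec]
    simp only [c, Finset.sum_const, Finset.card_univ, nsmul_eq_mul, Pi.smul_apply, smul_eq_mul]
    ring
  have hdec : (Pi.single u 1 : V → ℂ) = (1 / 2 : ℂ) • f + (1 / 2 : ℂ) • g + c := by
    ext w
    simp only [f, g, c, Pi.add_apply, Pi.sub_apply, Pi.smul_apply, smul_eq_mul]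
    ring
  rw [quantumWalk]
  conv_lhs => rw [hdec]
  rw [Matrix.mulVec_add, Matrix.mulVec_add, Matrix.mulVec_smul, Matrix.mulVec_smul,
    matrix_exp_smul_mulVec _ _ _ _ hf, matrix_exp_smul_mulVec _ _ _ _ hg,
    matrix_exp_smul_mulVec _ _ _ _ hc, mul_zero, Complex.exp_zero, one_smul, smul_smul]
  congr 3
  ring

theorem IsCocktailParty.hasPerfectStateTransferAt_pi_div_two (h : G.IsCocktailParty σ) {m : ℕ}
    (hcard : Fintype.card V = 2 * m) (hm : 0 < m) (heven : Even m) :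
    G.HasPerfectStateTransferAt (Real.pi / 2) := by
  obtain ⟨u⟩ : Nonempty V := Fintype.card_pos_iff.1 (by omega)
  refine ⟨u, σ u, (h.ne u).symm, -1, ?_⟩
  have hm0 : (m : ℂ) ≠ 0 := by exact_mod_cast hm.ne'
  rw [h.quantumWalk_mulVec_single, hcard]
  have e1 : Complex.exp (Complex.I * ((Real.pi / 2 : ℝ) : ℂ) * -2) = -1 := by
    rw [show Complex.I * ((Real.pi / 2 : ℝ) : ℂ) * -2 = -(Real.pi * Complex.I) by
      push_cast; ring, Complex.exp_neg, Complex.exp_pi_mul_I]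
    norm_num
  have e2 : Complex.exp (Complex.I * ((Real.pi / 2 : ℝ) : ℂ) * (((2 * m : ℕ) : ℂ) - 2)) = -1 := by
    rw [show Complex.I * ((Real.pi / 2 : ℝ) : ℂ) * (((2 * m : ℕ) : ℂ) - 2) =
      m * (Real.pi * Complex.I) - Real.pi * Complex.I by push_cast; ring, Complex.exp_sub,
      Complex.exp_nat_mul, Complex.exp_pi_mul_I, heven.neg_one_pow]
    norm_num
  rw [e1, e2]
  ext w
  simp only [Pi.add_apply, Pi.sub_apply, Pi.smul_apply, smul_eq_mul]
  push_cast
  field_simp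
  ring

/-- Vanishing at a third vertex equates the two nontrivial phases; vanishing at `u` makes them `-1`.
The identity `exp((2m - 2)it) * exp(-2it)^m = exp(-2it)` then reads `(-1)^m = 1`. -/
theorem IsCocktailParty.even_of_mulVec_eq (h : G.IsCocktailParty σ) {m : ℕ}
    (hcard : Fintype.card V = 2 * m) (hm : 2 ≤ m) {t : ℝ} {u : V} {z : ℂ}
    (hz : (G.quantumWalk t).mulVec (Pi.single u 1) = z • (Pi.single (σ u) 1 : V → ℂ)) :
    Even m := by
  obtain ⟨p, hp, hp'⟩ := IsCocktailParty.exists_ne_of_two_lt_card (σ := σ)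
    (show 2 < Fintype.card V by omega) u
  have hm0 : (m : ℂ) ≠ 0 := by exact_mod_cast (by omega : m ≠ 0)
  rw [h.quantumWalk_mulVec_single, hcard] at hz
  have h1 := congrFun hz u
  have h2 := congrFun hz p
  have hne := h.ne u
  simp only [Pi.add_apply, Pi.sub_apply, Pi.smul_apply, smul_eq_mul, Pi.single_eq_same,
    Pi.single_eq_of_ne hp, Pi.single_eq_of_ne hp', Pi.single_eq_of_ne hne.symm] at h1 h2
  have hprod : Complex.exp (Complex.I * t * (((2 * m : ℕ) : ℂ) - 2)) *
      Complex.exp (Complex.I * t * -2) ^ m = Complex.exp (Complex.I * t * -2) := by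
    rw [← Complex.exp_nat_mul, ← Complex.exp_add]
    congr 1
    push_cast
    ring
  set x := Complex.exp (Complex.I * t * (((2 * m : ℕ) : ℂ) - 2))
  set w := Complex.exp (Complex.I * t * -2)
  push_cast at h1 h2
  field_simp at h1 h2
  have hxw : x = w := by linear_combination h2
  have hw : w = -1 := by
    have : (m : ℂ) * (1 + w) = 0 := by
      rw [hxw] at h1
      linear_combination h1
    rcases mul_eq_zero.1 this with h0 | h0
    · exact absurd h0 hm0
    · linear_combination h0
  rw [hxw, hw] at hprod
  by_contra hodd
  rw [(Nat.not_even_iff_odd.1 hodd).neg_one_pow] at hprod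
  norm_num at hprod

/-- A distance-regular graph of diameter two with perfect state transfer is a cocktail party graph,
and the transfer is between antipodes. -/
theorem IsDistanceRegular.exists_isCocktailParty (hG : G.IsDistanceRegular) (hdiam : G.diam = 2)
    {t : ℝ} {u v : V} (huv : u ≠ v) {z : ℂ}
    (hz : (G.quantumWalk t).mulVec (Pi.single u 1) = z • (Pi.single v 1 : V → ℂ)) :
    ∃ σ, G.IsCocktailParty σ ∧ σ u = v := by
  have hconn := hG.1
  obtain ⟨k, hk⟩ := hG.exists_degree_eq
  have huniq : ∀ w, G.dist u w = G.dist u v → w = v := fun w hw => hG.eq_of_dist_eq hz hw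
  have hle : ∀ a b, G.dist a b ≤ 2 := fun a b => by
    rw [← hdiam]
    have : Nonempty V := ⟨u⟩
    exact dist_le_diam (connected_iff_ediam_ne_top.1 hconn)
  have hpos := hconn.pos_dist_of_ne huv
  -- Otherwise `v` is the only neighbour of `u`, so all degrees are 1; but the midpoint of a
  -- geodesic of length 2 has two neighbours.
  have hnadj : ¬ G.Adj u v := by
    intro hadj
    have hdeg : ∀ a, G.degree a = 1 := by
      intro a
      rw [hk, ← hk u, ← card_neighborFinset_eq_degree, Finset.card_eq_one]
      refine ⟨v, ?_⟩
      ext w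
      rw [mem_neighborFinset, Finset.mem_singleton]
      refine ⟨fun hw => huniq w ?_, fun hw => hw ▸ hadj⟩
      rw [dist_eq_one_iff_adj.2 hw, dist_eq_one_iff_adj.2 hadj]
    have : Nonempty V := ⟨u⟩
    obtain ⟨x, y, hxy⟩ := G.exists_dist_eq_diam
    rw [hdiam] at hxy
    have hed : G.edist x y = 2 := by
      rw [← (hconn x y).coe_dist_eq_edist, hxy]; rfl
    obtain ⟨hne, -, w, hw⟩ := edist_eq_two_iff.1 hed
    rw [mem_commonNeighbors] at hw
    have hcard := hdeg w
    rw [← card_neighborFinset_eq_degree, Finset.card_eq_one] at hcard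
    obtain ⟨a, ha⟩ := hcard
    have hxa : x ∈ G.neighborFinset w := by simpa using hw.1.symm
    have hya : y ∈ G.neighborFinset w := by simpa using hw.2.symm
    rw [ha, Finset.mem_singleton] at hxa hya
    exact hne (hxa.trans hya.symm)
  -- By regularity the number of non-neighbours is the same at every vertex, and at `u` only `v` is
  -- one.
  have hfar : ∀ a, (Finset.univ \ insert a (G.neighborFinset a)).card = 1 := by
    have hcount : ∀ a, (Finset.univ \ insert a (G.neighborFinset a)).card =
        Fintype.card V - (k + 1) := by
      intro a
      rw [← Finset.compl_eq_univ_sdiff, Finset.card_compl, Finset.card_insert_of_notMem (by simp),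
        card_neighborFinset_eq_degree, hk]
    intro a
    rw [hcount, ← hcount u, Finset.card_eq_one]
    refine ⟨v, ?_⟩
    have hlt := hconn.one_lt_dist_of_ne_of_not_adj huv hnadj
    have hlev := hle u v
    ext w
    simp only [Finset.mem_sdiff, Finset.mem_univ, true_and, Finset.mem_insert, mem_neighborFinset,
      not_or, Finset.mem_singleton]
    constructor
    · rintro ⟨h1, h2⟩
      have := hconn.one_lt_dist_of_ne_of_not_adj (Ne.symm h1) h2
      have := hle u w
      exact huniq w (by omega)
    · rintro rfl
      exact ⟨huv.symm, hnadj⟩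
  simp only [Finset.card_eq_one] at hfar
  choose σ hσ using hfar
  have hmem : ∀ a w, (w ≠ a ∧ ¬ G.Adj a w) ↔ w = σ a := by
    intro a w
    have := congrArg (w ∈ ·) (hσ a)
    simpa using this
  refine ⟨σ, ⟨fun a => ((hmem a _).2 rfl).1, fun a => ?_, fun a w => ?_⟩, ?_⟩
  · obtain ⟨h1, h2⟩ := (hmem a _).2 rfl
    exact ((hmem _ _).1 ⟨h1.symm, fun hh => h2 hh.symm⟩).symm
  · rw [Ne, Ne, ← hmem]
    refine ⟨fun hh => ⟨hh.ne', fun hh' => hh'.2 hh⟩, fun hh => ?_⟩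
    by_contra hcon
    exact hh.2 ⟨hh.1, hcon⟩
  · exact ((hmem u v).1 ⟨huv.symm, hnadj⟩).symm

end QuantumWalk

end SimpleGraph

/-! ### The characterization. -/

theorem mainTheorem3 {V : Type*} [Fintype V] [DecidableEq V] (G : SimpleGraph V)
    [DecidableRel G.Adj] :
    (G.IsDistanceRegular → G.diam = 2 →
      (G.HasPerfectStateTransfer ↔
        ∃ m : ℕ, Even m ∧
          Nonempty (G ≃g (SimpleGraph.disjointCopies m (SimpleGraph.completeGraph (Fin 2)))ᶜ)) ∧
      (G.HasPerfectStateTransfer → G.HasPerfectStateTransferAt (Real.pi / 2))) ∧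
    (∀ m : ℕ, 0 < m → Even m →
      Nonempty (G ≃g (SimpleGraph.disjointCopies m (SimpleGraph.completeGraph (Fin 2)))ᶜ) →
        G.IsDistanceRegular ∧ G.diam = 2) := by
  refine ⟨fun hG hdiam => ?_, fun m hm heven ⟨e⟩ => ?_⟩
  · have hforward : G.HasPerfectStateTransfer → ∃ m : ℕ, Even m ∧
        Nonempty (G ≃g (SimpleGraph.disjointCopies m (SimpleGraph.completeGraph (Fin 2)))ᶜ) := by
      rintro ⟨t, -, u, v, huv, z, hz⟩
      obtain ⟨σ, hσ, rfl⟩ := hG.exists_isCocktailParty hdiam huv hz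
      obtain ⟨m, hcard, e⟩ := hσ.exists_iso
      refine ⟨m, hσ.even_of_mulVec_eq hcard ?_ hz, e⟩
      -- For `m = 1` the two vertices leave no room for a neighbour of `u`, which connectedness
      -- requires.
      by_contra hlt
      have hm : m = 1 := by
        have := Fintype.card_pos_iff.2 ⟨u⟩
        omega
      subst hm
      have hadj : ∃ w, G.Adj u w := by
        have : Nontrivial V := ⟨u, σ u, huv⟩
        exact hG.1.preconnected.exists_adj_of_nontrivial u
      obtain ⟨w, hw⟩ := hadj
      obtain ⟨h1, h2⟩ := (hσ.adj_iff u w).1 hw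
      have := Finset.card_le_univ {u, σ u, w}
      rw [Finset.card_eq_three.2 ⟨u, σ u, w, huv, h1.symm, h2.symm, rfl⟩] at this
      omega
    have hbackward : (∃ m : ℕ, Even m ∧ Nonempty
        (G ≃g (SimpleGraph.disjointCopies m (SimpleGraph.completeGraph (Fin 2)))ᶜ)) →
        G.HasPerfectStateTransferAt (Real.pi / 2) := by
      rintro ⟨m, heven, ⟨e⟩⟩
      obtain ⟨σ, hσ⟩ := SimpleGraph.exists_isCocktailParty_of_iso e
      have hcard := SimpleGraph.card_eq_of_iso e
      have hne : Nonempty V := hG.1.nonempty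
      have := Fintype.card_pos_iff.2 hne
      exact hσ.hasPerfectStateTransferAt_pi_div_two hcard (by omega) heven
    exact ⟨⟨hforward, fun h => ⟨_, Real.pi_div_two_pos.le, hbackward h⟩⟩,
      fun h => hbackward (hforward h)⟩
  · obtain ⟨σ, hσ⟩ := SimpleGraph.exists_isCocktailParty_of_iso e
    have hcard := SimpleGraph.card_eq_of_iso e
    -- Evenness excludes `m = 1`, the edgeless graph on two vertices.
    have : 2 < Fintype.card V := by
      obtain ⟨r, rfl⟩ := heven
      omega
    exact ⟨hσ.isDistanceRegular this, hσ.diam_eq_two this⟩
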